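/- Let $n\ge 1$ and $A\in M_n(\mathbb C)$. For $\mathbb F\in\{\mathbb C,\mathbb H\}$ and a matrix $M\in M_n(\mathbb F)$ let $W_{\mathbb F}(M)=\{x^*Mx : x\in\mathbb F^n,\ \sum_i|x_i|^2=1\}$ be its numerical range over $\mathbb F$. Regard $\mathbb C$ as the subfield $\mathrm{span}_{\mathbb R}\{1,i\}$ of the Hamilton quaternions $\mathbb H$, and so $A$ as a quaternionic matrix. Let $\mathbb C^+=\{z\in\mathbb C:\operatorname{Im} z\ge 0\}$, let $B(A)=W_{\mathbb H}(A)\cap\mathbb C$ be the bild of $A$, let $B^+(A)=B(A)\cap\mathbb C^+$ be its upper bild, and let $W_{\mathbb C}^+(M)=W_{\mathbb C}(M)\cap\mathbb C^+$. If $B(A)\cap\mathbb R$ is non-empty, which is always the case when $n\ge 2$, then $\underline v=\min(B(A)\cap\mathbb R)$ and $\overline v=\max(B(A)\cap\mathbb R)$ exist, and $$B^+(A)=\operatorname{conv}\bigl(W_{\mathbb C}^+(A)\cup W_{\mathbb C}^+(A^*)\cup\{\underline v,\overline v\}\bigr).$$ If $B(A)\cap\mathbb R$ is empty (so $n=1$),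 the same holds without the undefined points: $B^+(A)=\operatorname{conv}\bigl(W_{\mathbb C}^+(A)\cup W_{\mathbb C}^+(A^*)\bigr)$. -/

import Mathlib

open scoped Matrix Quaternion

/-- The numerical range `W_F(A)`: the set of all `x^* A x` with `x` on the unit sphere of `F^n`.
It is used for `F = ℂ` and `F = ℍ`. -/
def numericalRange {F : Type*} [NormedRing F] [StarRing F] {n : ℕ}
    (A : Matrix (Fin n) (Fin n) F) : Set F :=
  {w | ∃ x : Fin n → F, ∑ i, ‖x i‖ ^ 2 = 1 ∧ star x ⬝ᵥ (A *ᵥ x) = w}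

/-- A complex matrix regarded as a quaternionic one. -/
noncomputable def toQuaternionMatrix {n : ℕ} (A : Matrix (Fin n) (Fin n) ℂ) : Matrix (Fin n) (Fin n) ℍ :=
  A.map Quaternion.ofComplex

/-- The closed upper half plane `ℂ⁺`. -/
def closedUpperHalfPlane : Set ℂ := {z | 0 ≤ z.im}

/-- The bild `B(A) = W_ℍ(A) ∩ ℂ` of a quaternionic matrix, as a set of complex numbers. -/
def bild {n : ℕ} (A : Matrix (Fin n) (Fin n) ℍ) : Set ℂ :=
  {z | Quaternion.ofComplex z ∈ numericalRange A}

/-- The upper bild `B⁺(A) = B(A) ∩ ℂ⁺`. -/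
def upperBild {n : ℕ} (A : Matrix (Fin n) (Fin n) ℍ) : Set ℂ :=
  bild A ∩ closedUpperHalfPlane

/-- The real part `B(A) ∩ ℝ` of the bild, as a set of real numbers. -/
def realBild {n : ℕ} (A : Matrix (Fin n) (Fin n) ℍ) : Set ℝ :=
  {r | (r : ℂ) ∈ bild A}

/-- `W_ℂ⁺(A) = W_ℂ(A) ∩ ℂ⁺`. -/
def upperNumericalRange {n : ℕ} (A : Matrix (Fin n) (Fin n) ℂ) : Set ℂ :=
  numericalRange A ∩ closedUpperHalfPlane

/-!
The proof has two halves: the upper bild of every quaternionic matrix `M` is convex, and for a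
complex matrix it lies in the stated convex hull.

Convexity. Rotating a vector `x` from the right by a unit quaternion `v` conjugates `x^* M x` by
`v`, so the upper bild is the set of all points `(re (x^* M x), ‖im (x^* M x)‖)` with `x` a unit
vector (`mk_re_norm_im_mem_upperBild`). Let unit vectors `x`, `y` give two points of the upper bild
and let `im = m * re + c` be the line through these points. On vectors `s x + t y` the quadratic
map `x^* M x` has the cross term `s t (x^* M y + y^* M x)`, and replacing `y` by `y v` allows this
term to be adjusted.

* For one `v` the cross term is real, and replacing `v` by `-v` makes the cross term of
  `m * re + c` nonnegative. The triangle inequality then gives, at each real part in between, a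
  point on or below the chord (`exists_mem_upperBild_im_le`).
* For some complex `v` the `i`-component of the form equals `m * re + c` on the real span of `x` and
  `y v`. This gives a point on or above the chord (`exists_mem_upperBild_le_im`).
* Two unit vectors with the same real part `h` can be joined through vectors of real part `h`,
  since some `v` kills the cross term of `re - h * |x|^2`. Hence vertical sections are intervals
  (`mem_upperBild_of_le_of_le`).

Together these yield `convex_upperBild`.

Complex matrices. With `x = a + b j` for complex vectors `a` and `b`, the quaternion `x^* A x` is
complex exactly when `a^* (A - A^*) b = 0`, and it then equals `a^* A a + b^* A^* b`, a convex
combination of a point of `W(A)` and a point of `W(A^*)`. The orthogonality condition survives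
scaling `a` and `b` separately, so the whole segment between these two points lies in the bild. If
just one endpoint lies in the upper half plane, the part of the segment there ends at a real point
of the bild (`upperBild_subset_of_convex`). The real points of the bild form a compact set
(`isCompact_realBild`), nonempty for `n ≥ 2` (`realBild_nonempty`).
-/

/-! ### Quadratic functions along a path between two vectors -/

/-- The intermediate value theorem for the quotient `F / N` of two functions homogeneous of degree
two: it is applied to the path from `x` to `y` in the cone they span, normalized by `N`. -/
theorem exists_cone_combination_eq {E : Type*} [AddCommGroup E] [Module ℝ E] [TopologicalSpace E]
    [ContinuousAdd E] [ContinuousSMul ℝ E] {N F : E → ℝ} (hN : Continuous N) (hF : Continuous F)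
    (hN2 : ∀ (r : ℝ) x, N (r • x) = r ^ 2 * N x) (hF2 : ∀ (r : ℝ) x, F (r • x) = r ^ 2 * F x)
    (hpos : ∀ x, x ≠ 0 → 0 < N x) {x y : E} (hx : N x = 1) (hy : N y = 1) {c : ℝ}
    (hxc : F x ≤ c) (hcy : c ≤ F y) :
    ∃ s t : ℝ, 0 ≤ s ∧ 0 ≤ t ∧ N (s • x + t • y) = 1 ∧ F (s • x + t • y) = c := by
  rcases hxc.eq_or_lt with h | hxc
  · exact ⟨1, 0, by simp, le_rfl, by simpa using hx, by simpa using h⟩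
  rcases hcy.eq_or_lt with h | hcy
  · exact ⟨0, 1, le_rfl, by simp, by simpa using hy, by simpa using h.symm⟩
  have hcont : Continuous fun s : ℝ =>
      F ((1 - s) • x + s • y) - c * N ((1 - s) • x + s • y) := by fun_prop
  obtain ⟨s, ⟨hs0, hs1⟩, hs⟩ := intermediate_value_Icc (zero_le_one' ℝ) hcont.continuousOn
    (show (0 : ℝ) ∈ _ by constructor <;> simp [hx, hy] <;> linarith)
  set z := (1 - s) • x + s • y with hz
  replace hs : F z = c * N z := sub_eq_zero.1 hs
  have hz0 : z ≠ 0 := by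
    intro h0
    -- two dependent vectors with the same value of `N` have the same value of `F`
    have hxy : (1 - s) • x = (-s) • y := by
      rw [neg_smul]; exact eq_neg_of_add_eq_zero_left (hz ▸ h0)
    have h1 := congrArg N hxy
    have h2 := congrArg F hxy
    rw [hN2, hN2, hx, hy] at h1
    rw [hF2, hF2] at h2
    have h3 : s = 1 / 2 := by nlinarith
    subst h3
    norm_num at h2
    linarith
  have hNz := hpos z hz0
  have hr : (√(N z))⁻¹ ^ 2 * N z = 1 := by
    rw [inv_pow, Real.sq_sqrt hNz.le, inv_mul_cancel₀ hNz.ne']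
  have hzz : ((√(N z))⁻¹ * (1 - s)) • x + ((√(N z))⁻¹ * s) • y = (√(N z))⁻¹ • z := by
    rw [hz, smul_add, smul_smul, smul_smul]
  refine ⟨(√(N z))⁻¹ * (1 - s), (√(N z))⁻¹ * s, ?_, ?_, ?_, ?_⟩
  · exact mul_nonneg (by positivity) (by linarith)
  · exact mul_nonneg (by positivity) hs0
  · rw [hzz, hN2, hr]
  · rw [hzz, hF2, hs]; linear_combination c * hr

/-- A linear functional on the plane vanishes at some unit vector. -/
theorem exists_unit_linear_eq_zero (p q : ℝ) : ∃ r s : ℝ, r ^ 2 + s ^ 2 = 1 ∧ r * p + s * q = 0 := by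
  by_cases h : p ^ 2 + q ^ 2 = 0
  · have hp : p = 0 := by nlinarith [sq_nonneg p, sq_nonneg q]
    have hq : q = 0 := by nlinarith [sq_nonneg p, sq_nonneg q]
    exact ⟨1, 0, by norm_num, by simp [hp]⟩
  · have hpos : 0 < p ^ 2 + q ^ 2 := lt_of_le_of_ne (by positivity) (Ne.symm h)
    have hs := Real.sq_sqrt hpos.le
    have h0 : √(p ^ 2 + q ^ 2) ≠ 0 := (Real.sqrt_pos.2 hpos).ne'
    refine ⟨q / √(p ^ 2 + q ^ 2), -p / √(p ^ 2 + q ^ 2), ?_, by ring⟩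
    field_simp
    linarith

/-! ### The sesquilinear form of a quaternionic matrix -/

section Form

variable {n : ℕ} (M : Matrix (Fin n) (Fin n) ℍ)

/-- The sesquilinear form `x^* M y` of a quaternionic matrix. -/
noncomputable def sesqForm (x y : Fin n → ℍ) : ℍ := star x ⬝ᵥ (M *ᵥ y)

/-- The polarization `x^* M y + y^* M x` of the quadratic map `x ↦ x^* M x`. -/
noncomputable def polarForm (x y : Fin n → ℍ) : ℍ := sesqForm M x y + sesqForm M y x

/-- Scalar multiplication from the right, `ℍ^n` being a right vector space over `ℍ`. -/
noncomputable def mulRight (x : Fin n → ℍ) (v : ℍ) : Fin n → ℍ := fun i => x i * v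

/-- The square of the Euclidean norm of a quaternionic vector. -/
noncomputable def sqNorm (x : Fin n → ℍ) : ℝ := ∑ i, ‖x i‖ ^ 2

variable (x y z : Fin n → ℍ) (v : ℍ) (r s t : ℝ)

theorem sesqForm_add_left : sesqForm M (x + y) z = sesqForm M x z + sesqForm M y z := by
  simp [sesqForm, add_dotProduct]

theorem sesqForm_add_right : sesqForm M x (y + z) = sesqForm M x y + sesqForm M x z := by
  simp [sesqForm, Matrix.mulVec_add, dotProduct_add]

theorem sesqForm_smul_left : sesqForm M (r • x) y = r • sesqForm M x y := by
  have h : star (r • x) = r • star x := funext fun i => Quaternion.star_smul r (x i)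
  rw [sesqForm, h, smul_dotProduct, sesqForm]

theorem sesqForm_smul_right : sesqForm M x (r • y) = r • sesqForm M x y := by
  simp [sesqForm, Matrix.mulVec_smul, dotProduct_smul]

theorem sesqForm_mulRight_right : sesqForm M x (mulRight y v) = sesqForm M x y * v := by
  simp only [sesqForm, mulRight, dotProduct, Matrix.mulVec, Finset.sum_mul, Finset.mul_sum,
    mul_assoc]

theorem sesqForm_mulRight_left : sesqForm M (mulRight x v) y = star v * sesqForm M x y := by
  simp only [sesqForm, mulRight, dotProduct, Pi.star_apply, star_mul, Finset.mul_sum, mul_assoc]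

theorem sesqForm_mulRight_self :
    sesqForm M (mulRight x v) (mulRight x v) = star v * sesqForm M x x * v := by
  rw [sesqForm_mulRight_left, sesqForm_mulRight_right, mul_assoc]

theorem sesqForm_smul_self : sesqForm M (r • x) (r • x) = r ^ 2 • sesqForm M x x := by
  rw [sesqForm_smul_left, sesqForm_smul_right, smul_smul, sq]

theorem sesqForm_cone_combination :
    sesqForm M (s • x + t • y) (s • x + t • y) =
      s ^ 2 • sesqForm M x x + t ^ 2 • sesqForm M y y + (s * t) • polarForm M x y := by
  simp only [sesqForm_add_left, sesqForm_add_right, sesqForm_smul_left, sesqForm_smul_right,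
    polarForm, smul_add, smul_smul]
  rw [mul_comm t s, sq, sq]; abel

theorem polarForm_combination_right :
    polarForm M x (s • y + t • z) = s • polarForm M x y + t • polarForm M x z := by
  simp only [sesqForm_add_left, sesqForm_add_right, sesqForm_smul_left, sesqForm_smul_right,
    polarForm, smul_add]
  abel

theorem polarForm_neg_right : polarForm M x (-y) = -polarForm M x y := by
  simpa using polarForm_combination_right M x y 0 (-1) 0

theorem sesqForm_neg_self : sesqForm M (-x) (-x) = sesqForm M x x := by
  simpa using sesqForm_smul_self M x (-1)

theorem polarForm_mulRight :
    polarForm M x (mulRight y v) = sesqForm M x y * v + star v * sesqForm M y x := by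
  rw [polarForm, sesqForm_mulRight_left, sesqForm_mulRight_right]

theorem sesqForm_one_self : (sesqForm (1 : Matrix (Fin n) (Fin n) ℍ) x x).re = sqNorm x := by
  have h : ∀ q : ℍ, (star q * q).re = ‖q‖ ^ 2 := fun q => by
    rw [Quaternion.star_mul_self, Quaternion.re_coe, Quaternion.normSq_eq_norm_mul_self, sq]
  have h2 : ∀ f : Fin n → ℍ, (∑ i, f i).re = ∑ i, (f i).re := fun f =>
    map_sum (AddMonoidHom.mk' (fun q : ℍ => q.re) fun _ _ => rfl) f Finset.univ
  simp only [sesqForm, Matrix.one_mulVec, dotProduct, Pi.star_apply, sqNorm, h2, h]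

theorem sqNorm_cone_combination :
    sqNorm (s • x + t • y) = s ^ 2 * sqNorm x + t ^ 2 * sqNorm y + s * t * (polarForm 1 x y).re := by
  simp [← sesqForm_one_self, sesqForm_cone_combination]

theorem sqNorm_smul : sqNorm (r • x) = r ^ 2 * sqNorm x := by
  simp [sqNorm, norm_smul, mul_pow, Finset.mul_sum]

theorem sqNorm_neg : sqNorm (-x) = sqNorm x := by
  simp [sqNorm]

theorem sqNorm_mulRight : sqNorm (mulRight x v) = sqNorm x * ‖v‖ ^ 2 := by
  simp [sqNorm, mulRight, mul_pow, Finset.sum_mul]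

variable {x} in
theorem sqNorm_pos (hx : x ≠ 0) : 0 < sqNorm x := by
  obtain ⟨i, hi⟩ := Function.ne_iff.1 hx
  exact Finset.sum_pos' (fun _ _ => by positivity)
    ⟨i, Finset.mem_univ i, pow_pos (norm_pos_iff.2 hi) 2⟩

@[fun_prop]
theorem continuous_sqNorm : Continuous (sqNorm : (Fin n → ℍ) → ℝ) := by
  unfold sqNorm; fun_prop

@[fun_prop]
theorem continuous_sesqForm_self : Continuous fun x => sesqForm M x x := by
  unfold sesqForm; simp only [dotProduct, Matrix.mulVec, Pi.star_apply]; fun_prop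

end Form

/-! ### Rotating quaternions by unit quaternions -/

theorem norm_im_star_mul_mul (q : ℍ) {v : ℍ} (hv : ‖v‖ = 1) :
    ‖(star v * q * v).im‖ = ‖q.im‖ := by
  have h : (star v * q * v).im = star v * q.im * v := by
    ext <;> simp <;> ring
  rw [h, norm_mul, norm_mul, norm_star, hv, one_mul, mul_one]

theorem re_star_mul_mul (q : ℍ) {v : ℍ} (hv : ‖v‖ = 1) : (star v * q * v).re = q.re := by
  have h : (star v * q * v).re = Quaternion.normSq v * q.re := by
    rw [Quaternion.normSq_def']; simp; ring
  rw [h, Quaternion.normSq_eq_norm_mul_self, hv, one_mul, one_mul]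

theorem norm_im_ofComplex (z : ℂ) : ‖(Quaternion.ofComplex z).im‖ = |z.im| := by
  have h : ‖(Quaternion.ofComplex z).im‖ ^ 2 = z.im ^ 2 := by
    rw [sq, ← Quaternion.normSq_eq_norm_mul_self, Quaternion.normSq_def']
    simp [Quaternion.coe_ofComplex]
  rw [← abs_norm]; exact (sq_eq_sq_iff_abs_eq_abs _ _).1 h

/-- Every quaternion is conjugate, by a unit quaternion, to a complex number in the closed upper
half plane. -/
theorem exists_unit_star_mul_mul_eq (q : ℍ) :
    ∃ v : ℍ, ‖v‖ = 1 ∧ star v * q * v = Quaternion.ofComplex ⟨q.re, ‖q.im‖⟩ := by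
  set c : ℝ := ‖q.im‖ with hc
  have hc2 : c ^ 2 = q.imI ^ 2 + q.imJ ^ 2 + q.imK ^ 2 := by
    rw [hc, sq, ← Quaternion.normSq_eq_norm_mul_self, Quaternion.normSq_def']; simp
  -- it is enough that `v` intertwines `q` with the complex number
  suffices h : ∃ v : ℍ, v ≠ 0 ∧ q * v = v * Quaternion.ofComplex ⟨q.re, c⟩ by
    obtain ⟨v, hv, h⟩ := h
    have hv' : ‖v‖ ≠ 0 := norm_ne_zero_iff.2 hv
    refine ⟨‖v‖⁻¹ • v, by rw [norm_smul, norm_inv, norm_norm, inv_mul_cancel₀ hv'], ?_⟩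
    rw [mul_smul_comm, Quaternion.star_smul, smul_mul_assoc, smul_mul_assoc, smul_smul, mul_assoc, h,
      ← mul_assoc, Quaternion.star_mul_self, Quaternion.normSq_eq_norm_mul_self,
      Quaternion.coe_mul_eq_smul, smul_smul]
    rw [show ‖v‖⁻¹ * ‖v‖⁻¹ * (‖v‖ * ‖v‖) = 1 by field_simp, one_smul]
  obtain ⟨v, v0, v1, v2, v3⟩ :
      ∃ v : ℍ, v.re = 0 ∧ v.imI = q.imI + c ∧ v.imJ = q.imJ ∧ v.imK = q.imK :=
    ⟨⟨0, q.imI + c, q.imJ, q.imK⟩, rfl, rfl, rfl, rfl⟩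
  by_cases h0 : v = 0
  · -- here `im q = -c i`, which conjugation by `j` turns into `c i`
    obtain ⟨u, u0, u1, u2, u3⟩ : ∃ u : ℍ, u.re = 0 ∧ u.imI = 0 ∧ u.imJ = 1 ∧ u.imK = 0 :=
      ⟨⟨0, 0, 1, 0⟩, rfl, rfl, rfl, rfl⟩
    simp only [h0, Quaternion.imI_zero, Quaternion.imJ_zero, Quaternion.imK_zero] at v1 v2 v3
    refine ⟨u, fun h => by simp [h] at u2, ?_⟩
    ext <;> simp [Quaternion.coe_ofComplex, u0, u1, u2, u3, ← v2, ← v3]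
    linarith
  · refine ⟨v, h0, ?_⟩
    ext <;> simp [Quaternion.coe_ofComplex, v0, v1, v2, v3] <;> linarith

/-- Some unit quaternion makes `p v + v^* q` real. -/
theorem exists_unit_im_eq_zero (p q : ℍ) : ∃ v : ℍ, ‖v‖ = 1 ∧ (p * v + star v * q).im = 0 := by
  -- the imaginary part of `p v + v^* q` is that of `(p - q^*) v`
  suffices h : ∃ v : ℍ, ‖v‖ = 1 ∧ ((p - star q) * v).im = 0 by
    obtain ⟨v, hv, h⟩ := h
    refine ⟨v, hv, ?_⟩
    rw [← h]; ext <;> simp <;> ring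
  generalize p - star q = w
  by_cases hw : w = 0
  · exact ⟨1, by simp, by simp [hw]⟩
  · have hw' : ‖w‖ ≠ 0 := norm_ne_zero_iff.2 hw
    refine ⟨‖w‖⁻¹ • star w, ?_, ?_⟩
    · rw [norm_smul, norm_star, norm_inv, norm_norm, inv_mul_cancel₀ hw']
    · rw [mul_smul_comm, Quaternion.self_mul_star, Quaternion.im_smul, Quaternion.im_coe, smul_zero]

/-! ### Convexity of the upper bild of a quaternionic matrix -/

section UpperBild

variable {n : ℕ} {M : Matrix (Fin n) (Fin n) ℍ}

theorem mem_bild_iff {z : ℂ} :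
    z ∈ bild M ↔ ∃ x, sqNorm x = 1 ∧ sesqForm M x x = Quaternion.ofComplex z := Iff.rfl

/-- The upper bild records the real part of `x^* M x` and the norm of its imaginary part. -/
theorem mk_re_norm_im_mem_upperBild {x : Fin n → ℍ} (hx : sqNorm x = 1) :
    (⟨(sesqForm M x x).re, ‖(sesqForm M x x).im‖⟩ : ℂ) ∈ upperBild M := by
  obtain ⟨v, hv, h⟩ := exists_unit_star_mul_mul_eq (sesqForm M x x)
  refine ⟨mem_bild_iff.2 ⟨mulRight x v, ?_, ?_⟩, norm_nonneg (sesqForm M x x).im⟩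
  · rw [sqNorm_mulRight, hx, hv]; norm_num
  · rw [sesqForm_mulRight_self, h]

theorem re_smul_add_smul_sesqForm_self (x y : Fin n → ℍ) (s t : ℝ) :
    (sesqForm M (s • x + t • y) (s • x + t • y)).re =
      s ^ 2 * (sesqForm M x x).re + t ^ 2 * (sesqForm M y y).re
        + s * t * (polarForm M x y).re := by
  simp [sesqForm_cone_combination]

/-- The path lemma for the real part of the quadratic form. -/
theorem exists_unit_combination_re_eq {x y : Fin n → ℍ} (hx : sqNorm x = 1) (hy : sqNorm y = 1)
    {h : ℝ} (hxh : (sesqForm M x x).re ≤ h) (hhy : h ≤ (sesqForm M y y).re) :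
    ∃ s t : ℝ, 0 ≤ s ∧ 0 ≤ t ∧ sqNorm (s • x + t • y) = 1 ∧
      (sesqForm M (s • x + t • y) (s • x + t • y)).re = h :=
  exists_cone_combination_eq (F := fun x => (sesqForm M x x).re) continuous_sqNorm
    (Quaternion.continuous_re.comp (continuous_sesqForm_self M))
    (fun r x => sqNorm_smul x r) (fun r x => by simp [sesqForm_smul_self])
    (fun _ => sqNorm_pos) hx hy hxh hhy

/-- Over the chord joining two points of the upper bild, some point of the upper bild lies on or
below the chord. The chord lies on the line `im = m * re + c`. -/
theorem exists_mem_upperBild_im_le {z w : ℂ} (hz : z ∈ upperBild M) (hw : w ∈ upperBild M)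
    {m c h : ℝ} (hzl : z.im = m * z.re + c) (hwl : w.im = m * w.re + c)
    (hzh : z.re ≤ h) (hhw : h ≤ w.re) :
    ∃ u ∈ upperBild M, u.re = h ∧ u.im ≤ m * h + c := by
  obtain ⟨⟨x, hx, hxz⟩, hz0 : 0 ≤ z.im⟩ := hz
  obtain ⟨⟨y, hy, hyw⟩, hw0 : 0 ≤ w.im⟩ := hw
  change sqNorm x = 1 at hx
  change sesqForm M x x = _ at hxz
  change sqNorm y = 1 at hy
  change sesqForm M y y = _ at hyw
  -- rotating `y` kills the imaginary part of the cross term; the sign of `y` is still free and is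
  -- chosen to make the cross term of `m * re (x^* M x) + c * |x|^2` nonnegative
  obtain ⟨y', hy', him, hre, hnorm, hcross⟩ : ∃ y', sqNorm y' = 1 ∧ (polarForm M x y').im = 0 ∧
      (sesqForm M y' y').re = w.re ∧ ‖(sesqForm M y' y').im‖ = w.im ∧
      0 ≤ m * (polarForm M x y').re + c * (polarForm 1 x y').re := by
    obtain ⟨v, hv, hv0⟩ := exists_unit_im_eq_zero (sesqForm M x y) (sesqForm M y x)
    have h1 : sqNorm (mulRight y v) = 1 := by rw [sqNorm_mulRight, hy, hv]; norm_num
    have h2 : (sesqForm M (mulRight y v) (mulRight y v)).re = w.re := by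
      rw [sesqForm_mulRight_self, re_star_mul_mul _ hv, hyw]
      simp [Quaternion.coe_ofComplex]
    have h3 : ‖(sesqForm M (mulRight y v) (mulRight y v)).im‖ = w.im := by
      rw [sesqForm_mulRight_self, norm_im_star_mul_mul _ hv, hyw, norm_im_ofComplex,
        abs_of_nonneg hw0]
    rw [← polarForm_mulRight] at hv0
    rcases le_total 0 (m * (polarForm M x (mulRight y v)).re
      + c * (polarForm 1 x (mulRight y v)).re) with h | h
    · exact ⟨mulRight y v, h1, hv0, h2, h3, h⟩
    · refine ⟨-mulRight y v, by rw [sqNorm_neg, h1], ?_, ?_, ?_, ?_⟩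
      · rw [polarForm_neg_right, Quaternion.im_neg, hv0, neg_zero]
      · rw [sesqForm_neg_self, h2]
      · rw [sesqForm_neg_self, h3]
      · simp only [polarForm_neg_right, Quaternion.re_neg]; linarith
  have hxre : (sesqForm M x x).re = z.re := by rw [hxz]; simp [Quaternion.coe_ofComplex]
  have hxim : ‖(sesqForm M x x).im‖ = z.im := by
    rw [hxz, norm_im_ofComplex, abs_of_nonneg hz0]
  obtain ⟨s, t, hs, ht, hst, hst'⟩ := exists_unit_combination_re_eq (M := M) hx hy'
    (hxre.trans_le hzh) (hhw.trans_eq hre.symm)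
  refine ⟨_, mk_re_norm_im_mem_upperBild hst, hst', ?_⟩
  have hle : ‖(sesqForm M (s • x + t • y') (s • x + t • y')).im‖ ≤ s ^ 2 * z.im + t ^ 2 * w.im := by
    rw [sesqForm_cone_combination, Quaternion.im_add, Quaternion.im_add, Quaternion.im_smul,
      Quaternion.im_smul, Quaternion.im_smul, him, smul_zero, add_zero]
    refine (norm_add_le _ _).trans_eq ?_
    rw [norm_smul, norm_smul, hxim, hnorm, Real.norm_of_nonneg (sq_nonneg s),
      Real.norm_of_nonneg (sq_nonneg t)]
  refine hle.trans ?_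
  rw [re_smul_add_smul_sesqForm_self, hxre, hre] at hst'
  rw [sqNorm_cone_combination, hx, hy'] at hst
  rw [hzl, hwl]
  have hnn := mul_nonneg (mul_nonneg hs ht) hcross
  linear_combination hnn + m * hst' + c * hst

/-- A complex unit scalar can be moved into the right vector so as to kill a given real-linear
functional of the cross term. -/
theorem exists_mulRight_linear_eq_zero (l : (Fin n → ℍ) → ℝ) (y : Fin n → ℍ)
    (hl : ∀ (r s : ℝ) y z, l (r • y + s • z) = r * l y + s * l z) :
    ∃ a : ℂ, ‖Quaternion.ofComplex a‖ = 1 ∧ l (mulRight y (Quaternion.ofComplex a)) = 0 := by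
  obtain ⟨r, s, hrs, h⟩ :=
    exists_unit_linear_eq_zero (l y) (l (mulRight y (Quaternion.ofComplex Complex.I)))
  refine ⟨⟨r, s⟩, ?_, ?_⟩
  · have h1 : ‖Quaternion.ofComplex ⟨r, s⟩‖ ^ 2 = 1 := by
      rw [sq, ← Quaternion.normSq_eq_norm_mul_self, Quaternion.normSq_def']
      simpa [Quaternion.coe_ofComplex] using hrs
    exact (pow_eq_one_iff_of_nonneg (norm_nonneg _) two_ne_zero).1 h1
  · rw [← h, ← hl]
    congr 1
    funext i
    ext <;> simp [mulRight, Quaternion.coe_ofComplex] <;> ring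

/-- Over the chord joining two points of the upper bild, some point of the upper bild lies on or
above the chord. -/
theorem exists_mem_upperBild_le_im {z w : ℂ} (hz : z ∈ upperBild M) (hw : w ∈ upperBild M)
    {m c h : ℝ} (hzl : z.im = m * z.re + c) (hwl : w.im = m * w.re + c)
    (hzh : z.re ≤ h) (hhw : h ≤ w.re) :
    ∃ u ∈ upperBild M, u.re = h ∧ m * h + c ≤ u.im := by
  obtain ⟨⟨x, hx, hxz⟩, -⟩ := hz
  obtain ⟨⟨y, hy, hyw⟩, -⟩ := hw
  change sqNorm x = 1 at hx
  change sesqForm M x x = _ at hxz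
  change sqNorm y = 1 at hy
  change sesqForm M y y = _ at hyw
  -- for a complex unit `a`, the value of the form at `y a` is still `w`; with this choice of `a`
  -- the `i`-component of the form equals `m * re + c` on the whole plane spanned by `x` and `y a`
  obtain ⟨a, ha, hl⟩ := exists_mulRight_linear_eq_zero
    (fun y => (polarForm M x y).imI - m * (polarForm M x y).re - c * (polarForm 1 x y).re) y
    (fun r s y z => by simp only [polarForm_combination_right, Quaternion.imI_add,
      Quaternion.re_add, Quaternion.imI_smul, Quaternion.re_smul, smul_eq_mul]; ring)
  set y' := mulRight y (Quaternion.ofComplex a)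
  have hy' : sqNorm y' = 1 := by rw [sqNorm_mulRight, hy, ha]; norm_num
  have hyw' : sesqForm M y' y' = Quaternion.ofComplex w := by
    rw [sesqForm_mulRight_self, hyw, mul_assoc, ← map_mul, mul_comm w a, map_mul, ← mul_assoc,
      Quaternion.star_mul_self, Quaternion.normSq_eq_norm_mul_self, ha, one_mul,
      Quaternion.coe_one, one_mul]
  have hxre : (sesqForm M x x).re = z.re := by rw [hxz]; simp [Quaternion.coe_ofComplex]
  have hyre : (sesqForm M y' y').re = w.re := by rw [hyw']; simp [Quaternion.coe_ofComplex]
  have hxim : (sesqForm M x x).imI = z.im := by rw [hxz]; simp [Quaternion.coe_ofComplex]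
  have hyim : (sesqForm M y' y').imI = w.im := by rw [hyw']; simp [Quaternion.coe_ofComplex]
  obtain ⟨s, t, hs, ht, hst, hst'⟩ := exists_unit_combination_re_eq (M := M) hx hy'
    (hxre.trans_le hzh) (hhw.trans_eq hyre.symm)
  refine ⟨_, mk_re_norm_im_mem_upperBild hst, hst', ?_⟩
  have him : (sesqForm M (s • x + t • y') (s • x + t • y')).imI = m * h + c := by
    rw [re_smul_add_smul_sesqForm_self, hxre, hyre] at hst'
    rw [sqNorm_cone_combination, hx, hy'] at hst
    rw [sesqForm_cone_combination]
    simp only [Quaternion.imI_add, Quaternion.imI_smul, smul_eq_mul, hxim, hyim, hzl, hwl]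
    linear_combination (s * t) * hl + m * hst' + c * hst
  rw [← him]
  refine le_of_sq_le_sq ?_ (norm_nonneg _)
  rw [sq ‖_‖, ← Quaternion.normSq_eq_norm_mul_self, Quaternion.normSq_def']
  simp only [Quaternion.re_im, Quaternion.imI_im, Quaternion.imJ_im, Quaternion.imK_im]
  linarith [sq_nonneg (sesqForm M (s • x + t • y') (s • x + t • y')).imJ,
    sq_nonneg (sesqForm M (s • x + t • y') (s • x + t • y')).imK]

/-- Vertical sections of the upper bild are intervals: two unit vectors with the same value `h` of
`re (x^* M x)` can be joined by a path of such vectors, because one of them can be rotated until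
the cross term of `re (x^* M x) - h * |x|^2` vanishes. -/
theorem mem_upperBild_of_le_of_le {z w u : ℂ} (hz : z ∈ upperBild M) (hw : w ∈ upperBild M)
    (hzu : z.re = u.re) (hwu : w.re = u.re) (hzu' : z.im ≤ u.im) (huw' : u.im ≤ w.im) :
    u ∈ upperBild M := by
  obtain ⟨⟨x, hx, hxz⟩, hz0 : 0 ≤ z.im⟩ := hz
  obtain ⟨⟨y, hy, hyw⟩, hw0 : 0 ≤ w.im⟩ := hw
  change sqNorm x = 1 at hx
  change sesqForm M x x = _ at hxz
  change sqNorm y = 1 at hy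
  change sesqForm M y y = _ at hyw
  obtain ⟨a, ha, hl⟩ := exists_mulRight_linear_eq_zero
    (fun y => (polarForm M x y).re - u.re * (polarForm 1 x y).re) y
    (fun r s y z => by simp only [polarForm_combination_right,
      Quaternion.re_add, Quaternion.re_smul, smul_eq_mul]; ring)
  set y' := mulRight y (Quaternion.ofComplex a)
  have hy' : sqNorm y' = 1 := by rw [sqNorm_mulRight, hy, ha]; norm_num
  have hxre : (sesqForm M x x).re = u.re := by rw [hxz, ← hzu]; simp [Quaternion.coe_ofComplex]
  have hxim : ‖(sesqForm M x x).im‖ = z.im := by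
    rw [hxz, norm_im_ofComplex, abs_of_nonneg hz0]
  have hyre : (sesqForm M y' y').re = u.re := by
    rw [sesqForm_mulRight_self, re_star_mul_mul _ ha, hyw, ← hwu]
    simp [Quaternion.coe_ofComplex]
  have hyim : ‖(sesqForm M y' y').im‖ = w.im := by
    rw [sesqForm_mulRight_self, norm_im_star_mul_mul _ ha, hyw, norm_im_ofComplex,
      abs_of_nonneg hw0]
  obtain ⟨s, t, hs, ht, hst, hst'⟩ := exists_cone_combination_eq
    (F := fun x => ‖(sesqForm M x x).im‖) continuous_sqNorm
    (Quaternion.continuous_im.comp (continuous_sesqForm_self M)).norm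
    (fun r x => sqNorm_smul x r)
    (fun r x => by rw [sesqForm_smul_self, Quaternion.im_smul, norm_smul,
      Real.norm_of_nonneg (sq_nonneg r)])
    (fun _ => sqNorm_pos) hx hy' (hxim.trans_le hzu') (huw'.trans_eq hyim.symm)
  have hre : (sesqForm M (s • x + t • y') (s • x + t • y')).re = u.re := by
    rw [sqNorm_cone_combination, hx, hy'] at hst
    rw [re_smul_add_smul_sesqForm_self, hxre, hyre]
    linear_combination (s * t) * hl + u.re * hst
  have := mk_re_norm_im_mem_upperBild (M := M) hst
  rwa [hre, hst'] at this

/-- The upper bild of a quaternionic matrix is convex. -/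
theorem convex_upperBild (M : Matrix (Fin n) (Fin n) ℍ) : Convex ℝ (upperBild M) := by
  rw [convex_iff_segment_subset]
  intro z hz w hw
  wlog hle : z.re ≤ w.re generalizing z w
  · rw [segment_symm]; exact this hw hz (le_of_not_ge hle)
  rintro _ ⟨a, b, ha, hb, hab, rfl⟩
  have hre : (a • z + b • w).re = a * z.re + b * w.re := by simp
  have him : (a • z + b • w).im = a * z.im + b * w.im := by simp
  have ha' : a = 1 - b := by linarith
  rcases hle.eq_or_lt with heq | hlt
  · -- a vertical chord
    wlog hle' : z.im ≤ w.im generalizing z w a b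
    · rw [add_comm]
      exact this hw hz heq.ge b a hb ha (by linarith) (by simp) (by simp) (by linarith)
        heq.symm (le_of_not_ge hle')
    refine mem_upperBild_of_le_of_le hz hw ?_ ?_ ?_ ?_
    · rw [hre, ha', heq]; ring
    · rw [hre, ha', heq]; ring
    · rw [him, ha']; nlinarith
    · rw [him, ha']; nlinarith
  · obtain ⟨m, c, hzl, hwl⟩ : ∃ m c : ℝ, z.im = m * z.re + c ∧ w.im = m * w.re + c := by
      have hne : w.re - z.re ≠ 0 := (sub_pos.2 hlt).ne'
      refine ⟨(w.im - z.im) / (w.re - z.re), z.im - (w.im - z.im) / (w.re - z.re) * z.re,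
        by ring, ?_⟩
      field_simp
      ring
    have h1 : z.re ≤ a * z.re + b * w.re := by rw [ha']; nlinarith
    have h2 : a * z.re + b * w.re ≤ w.re := by rw [ha']; nlinarith
    have h3 : a * z.im + b * w.im = m * (a * z.re + b * w.re) + c := by
      rw [hzl, hwl, ha']; ring
    obtain ⟨u, hu, hur, hui⟩ := exists_mem_upperBild_im_le hz hw hzl hwl h1 h2
    obtain ⟨v, hv, hvr, hvi⟩ := exists_mem_upperBild_le_im hz hw hzl hwl h1 h2
    refine mem_upperBild_of_le_of_le hu hv (hur.trans hre.symm) (hvr.trans hre.symm) ?_ ?_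
    · rw [him, h3]; exact hui
    · rw [him, h3]; exact hvi

end UpperBild

/-! ### Complex matrices and pairs of complex vectors -/

section ComplexMatrix

variable {n : ℕ} (A : Matrix (Fin n) (Fin n) ℂ)

/-- The sesquilinear form `a^* A b` of a complex matrix. -/
noncomputable def complexForm (a b : Fin n → ℂ) : ℂ := star a ⬝ᵥ (A *ᵥ b)

/-- The quaternionic vector `a + b j`. Every quaternionic vector has exactly one such
representation with complex vectors `a` and `b`. -/
def ofComplexPair (a b : Fin n → ℂ) : Fin n → ℍ :=
  fun i => ⟨(a i).re, (a i).im, (b i).re, (b i).im⟩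

theorem exists_ofComplexPair_eq (x : Fin n → ℍ) : ∃ a b, ofComplexPair a b = x :=
  ⟨fun i => ⟨(x i).re, (x i).imI⟩, fun i => ⟨(x i).imJ, (x i).imK⟩, rfl⟩

theorem sqNorm_ofComplexPair (a b : Fin n → ℂ) :
    sqNorm (ofComplexPair a b) = ∑ i, ‖a i‖ ^ 2 + ∑ i, ‖b i‖ ^ 2 := by
  rw [sqNorm, ← Finset.sum_add_distrib]
  refine Finset.sum_congr rfl fun i _ => ?_
  rw [sq ‖ofComplexPair a b i‖, ← Quaternion.normSq_eq_norm_mul_self, Quaternion.normSq_def',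
    Complex.sq_norm, Complex.sq_norm, Complex.normSq_apply, Complex.normSq_apply]
  simp only [ofComplexPair]
  ring

theorem sesqForm_toQuaternionMatrix (a b : Fin n → ℂ) :
    sesqForm (toQuaternionMatrix A) (fun i => Quaternion.ofComplex (a i))
      (fun i => Quaternion.ofComplex (b i)) = Quaternion.ofComplex (complexForm A a b) := by
  have hstar : ∀ z : ℂ, star (Quaternion.ofComplex z) = Quaternion.ofComplex (star z) := by
    intro z; ext <;> simp [Quaternion.coe_ofComplex]
  simp only [sesqForm, complexForm, toQuaternionMatrix, dotProduct, Matrix.mulVec,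
    Matrix.map_apply, Pi.star_apply, map_sum, map_mul, hstar]

/-- With `x = a + b j`, the quaternion `x^* A x` has complex part `a^* A a + b^* A^* b`, and its
`j`-part is `a^* (A - A^*) b`. -/
theorem sesqForm_ofComplexPair_self (a b : Fin n → ℂ) :
    sesqForm (toQuaternionMatrix A) (ofComplexPair a b) (ofComplexPair a b) =
      ⟨(complexForm A a a + star (complexForm A b b)).re,
        (complexForm A a a + star (complexForm A b b)).im,
        (complexForm A a b - star (complexForm A b a)).re,
        (complexForm A a b - star (complexForm A b a)).im⟩ := by
  obtain ⟨j, j0, j1, j2, j3⟩ : ∃ j : ℍ, j.re = 0 ∧ j.imI = 0 ∧ j.imJ = 1 ∧ j.imK = 0 :=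
    ⟨⟨0, 0, 1, 0⟩, rfl, rfl, rfl, rfl⟩
  have h : ofComplexPair a b = (fun i => Quaternion.ofComplex (a i)) +
      mulRight (fun i => Quaternion.ofComplex (b i)) j := by
    funext i
    ext <;> simp [ofComplexPair, mulRight, Quaternion.coe_ofComplex, j0, j1, j2, j3]
  rw [h, sesqForm_add_left, sesqForm_add_right, sesqForm_add_right, sesqForm_mulRight_self,
    sesqForm_mulRight_left, sesqForm_mulRight_right]
  simp only [sesqForm_toQuaternionMatrix]
  ext <;> simp [Quaternion.coe_ofComplex, j0, j1, j2, j3]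
  ring

theorem mem_bild_toQuaternionMatrix_iff {z : ℂ} :
    z ∈ bild (toQuaternionMatrix A) ↔ ∃ a b : Fin n → ℂ, ∑ i, ‖a i‖ ^ 2 + ∑ i, ‖b i‖ ^ 2 = 1 ∧
      complexForm A a b = star (complexForm A b a) ∧
      complexForm A a a + star (complexForm A b b) = z := by
  rw [mem_bild_iff]
  constructor
  · rintro ⟨x, hx, hxz⟩
    obtain ⟨a, b, rfl⟩ := exists_ofComplexPair_eq x
    rw [sqNorm_ofComplexPair] at hx
    rw [sesqForm_ofComplexPair_self] at hxz
    refine ⟨a, b, hx, sub_eq_zero.1 (Complex.ext ?_ ?_), Complex.ext ?_ ?_⟩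
    · exact congrArg (·.imJ) hxz
    · exact congrArg (·.imK) hxz
    · exact congrArg (·.re) hxz
    · exact congrArg (·.imI) hxz
  · rintro ⟨a, b, h1, h2, h3⟩
    refine ⟨ofComplexPair a b, by rw [sqNorm_ofComplexPair, h1], ?_⟩
    rw [sesqForm_ofComplexPair_self, sub_eq_zero.2 h2, h3]
    rfl

theorem complexForm_smul_smul (s t : ℝ) (a b : Fin n → ℂ) :
    complexForm A (s • a) (t • b) = (s * t) • complexForm A a b := by
  have h : star (s • a) = s • star a := star_smul s a
  rw [complexForm, h, Matrix.mulVec_smul, smul_dotProduct, dotProduct_smul, smul_smul, complexForm]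

variable {A} in
theorem complexForm_smul_smul_eq_star {a b : Fin n → ℂ}
    (h : complexForm A a b = star (complexForm A b a)) (s t : ℝ) :
    complexForm A (s • a) (t • b) = star (complexForm A (t • b) (s • a)) := by
  rw [complexForm_smul_smul, complexForm_smul_smul, h, star_smul, star_trivial (t * s), mul_comm]

theorem complexForm_zero_left (b : Fin n → ℂ) : complexForm A 0 b = 0 := by simp [complexForm]

theorem complexForm_zero_right (a : Fin n → ℂ) : complexForm A a 0 = 0 := by simp [complexForm]

theorem complexForm_conjTranspose (a b : Fin n → ℂ) :
    complexForm Aᴴ a b = star (complexForm A b a) := by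
  rw [complexForm, complexForm, Matrix.dotProduct_mulVec, ← Matrix.star_mulVec,
    Matrix.star_dotProduct]

theorem sum_norm_sq_smul (s : ℝ) (a : Fin n → ℂ) :
    ∑ i, ‖(s • a) i‖ ^ 2 = s ^ 2 * ∑ i, ‖a i‖ ^ 2 := by
  simp [mul_pow, Finset.mul_sum]

theorem numericalRange_subset_bild : numericalRange A ⊆ bild (toQuaternionMatrix A) := by
  rintro _ ⟨a, ha, rfl⟩
  exact (mem_bild_toQuaternionMatrix_iff A).2 ⟨a, 0, by simpa using ha,
    by simp [complexForm_zero_left, complexForm_zero_right],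
    by simp [complexForm]⟩

theorem numericalRange_conjTranspose_subset_bild :
    numericalRange Aᴴ ⊆ bild (toQuaternionMatrix A) := by
  rintro _ ⟨b, hb, rfl⟩
  refine (mem_bild_toQuaternionMatrix_iff A).2 ⟨0, b, by simpa using hb,
    by simp [complexForm_zero_left, complexForm_zero_right], ?_⟩
  rw [complexForm_zero_left, zero_add, ← complexForm_conjTranspose, complexForm]

/-! ### The upper bild lies in the convex hull -/

/-- If a convex set contains the endpoints of a segment that lie in the closed upper half plane
and the points where the segment meets the real line, it contains the part of the segment in the
closed upper half plane. -/
theorem mem_of_mem_segment_of_im_nonneg {C : Set ℂ} (hC : Convex ℝ C) {u v z : ℂ}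
    (hu : 0 ≤ u.im → u ∈ C) (hv : 0 ≤ v.im → v ∈ C)
    (hreal : ∀ w ∈ segment ℝ u v, w.im = 0 → w ∈ C) (hz : z ∈ segment ℝ u v) (hz0 : 0 ≤ z.im) :
    z ∈ C := by
  wlog huv : v.im ≤ u.im generalizing u v
  · exact this hv hu (by rwa [segment_symm]) (by rwa [segment_symm]) (le_of_not_ge huv)
  rcases le_or_gt 0 v.im with hv0 | hv0
  · exact hC.segment_subset (hu (hv0.trans huv)) (hv hv0) hz
  obtain ⟨p, q, hp, hq, hpq, rfl⟩ := hz
  have hz1 : 0 ≤ p * u.im + q * v.im := by simpa using hz0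
  have hp' : p = 1 - q := by linarith
  have hu0 : 0 ≤ u.im := by
    by_contra h
    subst hp'
    rcases hp.eq_or_lt with h1 | h1 <;> nlinarith
  -- the segment meets the real line at the point with weights `-v.im / d` and `u.im / d`
  set d := u.im - v.im with hd
  have hd0 : 0 < d := by linarith
  set w : ℂ := (-v.im / d) • u + (u.im / d) • v with hw
  have hwC : w ∈ C := by
    refine hreal w ⟨_, _, div_nonneg (by linarith) hd0.le, div_nonneg hu0 hd0.le, ?_, rfl⟩ ?_
    · rw [← add_div, div_eq_one_iff_eq hd0.ne']; linarith
    · simp [hw]; ring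
  rcases hu0.eq_or_lt with h0 | h0
  · -- here `u` is real and `v` has weight zero
    have : q = 0 := by nlinarith
    subst this
    simpa [hp'] using hu hu0
  · have hsum : (p * u.im + q * v.im) / u.im + q * d / u.im = 1 := by
      rw [← add_div, div_eq_one_iff_eq h0.ne', hp', hd]; ring
    have h := hC (hu hu0) hwC (div_nonneg hz1 hu0) (div_nonneg (mul_nonneg hq hd0.le) hu0) hsum
    convert h using 1
    rw [hw, smul_add, smul_smul, smul_smul, ← add_assoc, ← add_smul]
    congr 2
    · field_simp; ring
    · field_simp

theorem exists_smul_sum_norm_sq_eq_one {a : Fin n → ℂ} (ha : ∑ i, ‖a i‖ ^ 2 ≠ 0) :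
    ∃ a' : Fin n → ℂ, ∑ i, ‖a' i‖ ^ 2 = 1 ∧ a = √(∑ i, ‖a i‖ ^ 2) • a' := by
  have hpos : 0 < ∑ i, ‖a i‖ ^ 2 :=
    lt_of_le_of_ne (Finset.sum_nonneg fun _ _ => by positivity) ha.symm
  have h0 : √(∑ i, ‖a i‖ ^ 2) ≠ 0 := (Real.sqrt_pos.2 hpos).ne'
  refine ⟨(√(∑ i, ‖a i‖ ^ 2))⁻¹ • a, ?_, by rw [smul_smul, mul_inv_cancel₀ h0, one_smul]⟩
  rw [sum_norm_sq_smul, inv_pow, Real.sq_sqrt hpos.le, inv_mul_cancel₀ hpos.ne']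

theorem eq_zero_of_sum_norm_sq_eq_zero {a : Fin n → ℂ} (ha : ∑ i, ‖a i‖ ^ 2 = 0) : a = 0 := by
  funext i
  have := (Finset.sum_eq_zero_iff_of_nonneg fun i _ => by positivity).1 ha i (Finset.mem_univ i)
  simpa using this

/-- Every point of the bild is a convex combination of a point of `W(A)` and one of `W(A^*)`,
and scaling the two components of a quaternionic vector separately keeps the whole segment between
these two points in the bild. -/
theorem upperBild_subset_of_convex {C : Set ℂ} (hC : Convex ℝ C)
    (h1 : upperNumericalRange A ⊆ C) (h2 : upperNumericalRange Aᴴ ⊆ C)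
    (hreal : ∀ r ∈ realBild (toQuaternionMatrix A), (r : ℂ) ∈ C) :
    upperBild (toQuaternionMatrix A) ⊆ C := by
  rintro z ⟨hz, hz0⟩
  obtain ⟨a, b, hab, hort, hzab⟩ := (mem_bild_toQuaternionMatrix_iff A).1 hz
  by_cases ha : ∑ i, ‖a i‖ ^ 2 = 0
  · obtain rfl := eq_zero_of_sum_norm_sq_eq_zero ha
    refine h2 ⟨⟨b, by simpa using hab, ?_⟩, hz0⟩
    rw [complexForm_zero_left, zero_add, ← complexForm_conjTranspose] at hzab
    exact hzab
  by_cases hb : ∑ i, ‖b i‖ ^ 2 = 0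
  · obtain rfl := eq_zero_of_sum_norm_sq_eq_zero hb
    refine h1 ⟨⟨a, by simpa using hab, ?_⟩, hz0⟩
    rw [complexForm_zero_left, star_zero, add_zero] at hzab
    exact hzab
  obtain ⟨a', ha', haa'⟩ := exists_smul_sum_norm_sq_eq_one ha
  obtain ⟨b', hb', hbb'⟩ := exists_smul_sum_norm_sq_eq_one hb
  set p := ∑ i, ‖a i‖ ^ 2
  set q := ∑ i, ‖b i‖ ^ 2
  have hp : 0 ≤ p := Finset.sum_nonneg fun _ _ => by positivity
  have hq : 0 ≤ q := Finset.sum_nonneg fun _ _ => by positivity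
  have hort' : complexForm A a' b' = star (complexForm A b' a') := by
    rw [haa', hbb', complexForm_smul_smul, complexForm_smul_smul, star_smul, star_trivial (√q * √p),
      mul_comm √q] at hort
    have h0 : √p * √q ≠ 0 := mul_ne_zero
      (Real.sqrt_ne_zero'.2 (lt_of_le_of_ne hp (Ne.symm ha)))
      (Real.sqrt_ne_zero'.2 (lt_of_le_of_ne hq (Ne.symm hb)))
    exact smul_right_injective ℂ h0 hort
  have hcomb : ∀ s t : ℝ, 0 ≤ s → 0 ≤ t →
      complexForm A (√s • a') (√s • a') + star (complexForm A (√t • b') (√t • b')) =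
        s • complexForm A a' a' + t • star (complexForm A b' b') := by
    intro s t hs ht
    rw [complexForm_smul_smul, complexForm_smul_smul, Real.mul_self_sqrt hs,
      Real.mul_self_sqrt ht, star_smul, star_trivial t]
  refine mem_of_mem_segment_of_im_nonneg hC (u := complexForm A a' a')
    (v := star (complexForm A b' b')) ?_ ?_ ?_ ?_ hz0
  · exact fun h => h1 ⟨⟨a', ha', rfl⟩, h⟩
  · exact fun h => h2 ⟨⟨b', hb', complexForm_conjTranspose A b' b'⟩, h⟩
  · rintro w ⟨s, t, hs, ht, hst, hw⟩ hw0
    have hwr : w = (w.re : ℂ) := Complex.ext rfl hw0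
    rw [hwr]
    refine hreal _ ?_
    change (w.re : ℂ) ∈ bild _
    rw [← hwr]
    refine (mem_bild_toQuaternionMatrix_iff A).2 ⟨√s • a', √t • b', ?_, ?_, ?_⟩
    · rw [sum_norm_sq_smul, sum_norm_sq_smul, ha', hb', Real.sq_sqrt hs, Real.sq_sqrt ht]
      linarith
    · exact complexForm_smul_smul_eq_star hort' _ _
    · rw [hcomb s t hs ht, hw]
  · refine ⟨p, q, hp, hq, hab, ?_⟩
    rw [← hcomb p q hp hq, ← haa', ← hbb', hzab]

/-! ### The real points of the bild -/

theorem isCompact_realBild (M : Matrix (Fin n) (Fin n) ℍ) : IsCompact (realBild M) := by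
  have hK : IsCompact {x : Fin n → ℍ | sqNorm x = 1 ∧ (sesqForm M x x).im = 0} := by
    have : ProperSpace ℍ := FiniteDimensional.proper_real ℍ
    refine Metric.isCompact_of_isClosed_isBounded ?_ ?_
    · exact (isClosed_eq continuous_sqNorm continuous_const).inter
        (isClosed_eq (Quaternion.continuous_im.comp (continuous_sesqForm_self M)) continuous_const)
    · refine (Metric.isBounded_closedBall (x := (0 : Fin n → ℍ)) (r := 1)).subset ?_
      rintro x ⟨hx, -⟩
      rw [mem_closedBall_zero_iff, pi_norm_le_iff_of_nonneg zero_le_one]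
      intro i
      have : ‖x i‖ ^ 2 ≤ 1 := hx ▸ Finset.single_le_sum (f := fun i => ‖x i‖ ^ 2)
        (fun _ _ => by positivity) (Finset.mem_univ i)
      exact (sq_le_one_iff₀ (norm_nonneg _)).1 this
  convert hK.image (Quaternion.continuous_re.comp (continuous_sesqForm_self M))
  ext r
  constructor
  · rintro ⟨x, hx, hxr⟩
    change sesqForm M x x = _ at hxr
    exact ⟨x, ⟨hx, by rw [hxr]; ext <;> simp⟩,
      by simp [hxr]⟩
  · rintro ⟨x, ⟨hx, hxr⟩, rfl⟩
    refine ⟨x, hx, ?_⟩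
    change sesqForm M x x = _
    rw [← Quaternion.re_add_im (sesqForm M x x), hxr]
    ext <;> simp

/-- A nonzero quaternionic vector `a + b j` at which the form is real yields, once normalized, a
real point of the bild. -/
theorem realBild_nonempty_of_im_eq_zero {a b : Fin n → ℂ} (h0 : a ≠ 0 ∨ b ≠ 0)
    (hort : complexForm A a b = star (complexForm A b a))
    (him : (complexForm A a a + star (complexForm A b b)).im = 0) :
    (realBild (toQuaternionMatrix A)).Nonempty := by
  have ha : 0 ≤ ∑ i, ‖a i‖ ^ 2 := Finset.sum_nonneg fun _ _ => by positivity
  have hb : 0 ≤ ∑ i, ‖b i‖ ^ 2 := Finset.sum_nonneg fun _ _ => by positivity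
  have hN : 0 < ∑ i, ‖a i‖ ^ 2 + ∑ i, ‖b i‖ ^ 2 := by
    refine lt_of_le_of_ne (add_nonneg ha hb) fun h => ?_
    rcases h0 with h0 | h0
    · exact h0 (eq_zero_of_sum_norm_sq_eq_zero (by linarith))
    · exact h0 (eq_zero_of_sum_norm_sq_eq_zero (by linarith))
  set N := ∑ i, ‖a i‖ ^ 2 + ∑ i, ‖b i‖ ^ 2 with hNdef
  refine ⟨(√N)⁻¹ ^ 2 * (complexForm A a a + star (complexForm A b b)).re,
    (mem_bild_toQuaternionMatrix_iff A).2 ⟨(√N)⁻¹ • a, (√N)⁻¹ • b, ?_, ?_, ?_⟩⟩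
  · rw [sum_norm_sq_smul, sum_norm_sq_smul, ← mul_add, ← hNdef, inv_pow, Real.sq_sqrt hN.le,
      inv_mul_cancel₀ hN.ne']
  · exact complexForm_smul_smul_eq_star hort _ _
  · rw [complexForm_smul_smul, complexForm_smul_smul, star_smul, star_trivial ((√N)⁻¹ * (√N)⁻¹),
      ← smul_add, sq]
    exact Complex.ext (by simp; ring) (by rw [Complex.smul_im, him]; simp)

theorem complexForm_add_left (a b c : Fin n → ℂ) :
    complexForm A (a + b) c = complexForm A a c + complexForm A b c := by
  simp [complexForm, add_dotProduct]

theorem complexForm_add_right (a b c : Fin n → ℂ) :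
    complexForm A a (b + c) = complexForm A a b + complexForm A a c := by
  simp [complexForm, Matrix.mulVec_add, dotProduct_add]

/-- Take `a` and `b` linearly independent and orthogonal for the skew-Hermitian part of `A`. When
`a^* A a` and `b^* A b` have imaginary parts of opposite signs, a combination of `a` and `b` has
a real value; when the signs agree, a combination of `a` and `b j` does. -/
theorem realBild_nonempty (hn : 2 ≤ n) : (realBild (toQuaternionMatrix A)).Nonempty := by
  let i₀ : Fin n := ⟨0, by omega⟩
  let i₁ : Fin n := ⟨1, by omega⟩
  have hi : i₁ ≠ i₀ := by simp [i₀, i₁]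
  set a : Fin n → ℂ := Pi.single i₀ 1 with ha
  have ha0 : a i₀ = 1 := by simp [ha]
  have ha1 : a i₁ = 0 := by simp [ha, hi]
  set c : Fin n → ℂ := Pi.single i₁ 1 with hc
  have hc1 : c i₁ = 1 := by simp [hc]
  set α := complexForm A a a - star (complexForm A a a) with hα
  set β := complexForm A a c - star (complexForm A c a) with hβ
  by_cases hα0 : α = 0
  · refine realBild_nonempty_of_im_eq_zero A (a := a) (b := 0) (Or.inl fun h => ?_) ?_ ?_
    · simp [h] at ha0
    · rw [complexForm_zero_left, complexForm_zero_right, star_zero]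
    · rw [complexForm_zero_left, star_zero, add_zero]
      exact Complex.conj_eq_iff_im.1 (sub_eq_zero.1 hα0).symm
  set b : Fin n → ℂ := β • a - α • c with hb
  have hb1 : b i₁ = -α := by simp [hb, ha1, hc1]
  have hab : complexForm A a b = star (complexForm A b a) := by
    have h1 : complexForm A a b = β * complexForm A a a - α * complexForm A a c := by
      simp [complexForm, hb, Matrix.mulVec_sub, Matrix.mulVec_smul]
    have h2 : complexForm A b a = star β * complexForm A a a - star α * complexForm A c a := by
      simp [complexForm, hb]
    rw [h1, h2, star_sub, star_mul', star_mul', star_star, star_star]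
    linear_combination β * hα - α * hβ
  set p := (complexForm A a a).im with hp
  set r := (complexForm A b b).im with hr
  have hp0 : p ≠ 0 := fun h => hα0 (sub_eq_zero.2 (Complex.conj_eq_iff_im.2 h).symm)
  have ht0 : √|p| ≠ 0 := Real.sqrt_ne_zero'.2 (abs_pos.2 hp0)
  have hs2 : √|r| * √|r| = |r| := Real.mul_self_sqrt (abs_nonneg r)
  have ht2 : √|p| * √|p| = |p| := Real.mul_self_sqrt (abs_nonneg p)
  have hne : √|p| • α ≠ 0 := smul_ne_zero ht0 hα0
  rcases le_or_gt 0 (p * r) with h | h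
  · refine realBild_nonempty_of_im_eq_zero A (a := √|r| • a) (b := √|p| • b)
      (Or.inr fun h => hne ?_) (complexForm_smul_smul_eq_star hab _ _) ?_
    · simpa [hb1] using congrFun h i₁
    · have h3 : |r| * p - |p| * r = 0 := by
        rcases abs_cases r with ⟨hr', _⟩ | ⟨hr', _⟩ <;>
        rcases abs_cases p with ⟨hp', _⟩ | ⟨hp', _⟩ <;> rw [hr', hp'] <;> nlinarith
      rw [complexForm_smul_smul, complexForm_smul_smul, hs2, ht2]
      simpa [← hp, ← hr, ← sub_eq_add_neg] using h3
  · refine realBild_nonempty_of_im_eq_zero A (a := √|r| • a + √|p| • b) (b := 0)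
      (Or.inl fun h => hne ?_) ?_ ?_
    · simpa [hb1, ha1] using congrFun h i₁
    · rw [complexForm_zero_left, complexForm_zero_right, star_zero]
    · have h3 : |r| * p + |p| * r = 0 := by
        rcases abs_cases r with ⟨hr', _⟩ | ⟨hr', _⟩ <;>
        rcases abs_cases p with ⟨hp', _⟩ | ⟨hp', _⟩ <;> rw [hr', hp'] <;> nlinarith
      have h4 : (complexForm A a b).im = -(complexForm A b a).im := by rw [hab]; simp
      rw [complexForm_zero_left, star_zero, add_zero]
      simp only [complexForm_add_left, complexForm_add_right, complexForm_smul_smul, hs2, ht2,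
        Complex.add_im, Complex.smul_im, smul_eq_mul, ← hp, ← hr, h4]
      linear_combination h3

end ComplexMatrix

/-! ### The upper bild as a convex hull -/

theorem theorem3p5 (n : ℕ) (A : Matrix (Fin n) (Fin n) ℂ) :
    ((realBild (toQuaternionMatrix A)).Nonempty →
      ∃ vmin vmax : ℝ,
        IsLeast (realBild (toQuaternionMatrix A)) vmin ∧
        IsGreatest (realBild (toQuaternionMatrix A)) vmax ∧
        upperBild (toQuaternionMatrix A) =
          convexHull ℝ (upperNumericalRange A ∪ upperNumericalRange Aᴴ ∪
            {(vmin : ℂ), (vmax : ℂ)})) ∧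
    (2 ≤ n → (realBild (toQuaternionMatrix A)).Nonempty) ∧
    (realBild (toQuaternionMatrix A) = ∅ →
      upperBild (toQuaternionMatrix A) =
        convexHull ℝ (upperNumericalRange A ∪ upperNumericalRange Aᴴ)) := by
  have hW : upperNumericalRange A ∪ upperNumericalRange Aᴴ ⊆ upperBild (toQuaternionMatrix A) :=
    Set.union_subset (Set.inter_subset_inter_left _ (numericalRange_subset_bild A))
      (Set.inter_subset_inter_left _ (numericalRange_conjTranspose_subset_bild A))
  refine ⟨fun hne => ?_, realBild_nonempty A, fun hempty => ?_⟩
  · obtain ⟨vmin, hmin⟩ := (isCompact_realBild (toQuaternionMatrix A)).exists_isLeast hne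
    obtain ⟨vmax, hmax⟩ := (isCompact_realBild (toQuaternionMatrix A)).exists_isGreatest hne
    refine ⟨vmin, vmax, hmin, hmax, Set.Subset.antisymm ?_ ?_⟩
    · refine upperBild_subset_of_convex A (convex_convexHull ℝ _) ?_ ?_ fun r hr => ?_
      · exact fun z hz => subset_convexHull ℝ _ (Or.inl (Or.inl hz))
      · exact fun z hz => subset_convexHull ℝ _ (Or.inl (Or.inr hz))
      · have h1 : (vmin : ℂ) ∈ convexHull ℝ (upperNumericalRange A ∪ upperNumericalRange Aᴴ ∪
            {(vmin : ℂ), (vmax : ℂ)}) := subset_convexHull ℝ _ (Or.inr (Or.inl rfl))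
        have h2 : (vmax : ℂ) ∈ convexHull ℝ (upperNumericalRange A ∪ upperNumericalRange Aᴴ ∪
            {(vmin : ℂ), (vmax : ℂ)}) := subset_convexHull ℝ _ (Or.inr (Or.inr rfl))
        refine (convex_convexHull ℝ _).segment_subset h1 h2 ?_
        have hseg : r ∈ segment ℝ vmin vmax := by
          rw [segment_eq_Icc (hmin.2 hmax.1)]; exact ⟨hmin.2 hr, hmax.2 hr⟩
        obtain ⟨s, t, hs, ht, hst, rfl⟩ := hseg
        exact ⟨s, t, hs, ht, hst, by simp⟩
    · refine convexHull_min (Set.union_subset hW ?_) (convex_upperBild _)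
      rintro _ (rfl | rfl)
      · exact ⟨hmin.1, by simp [closedUpperHalfPlane]⟩
      · exact ⟨hmax.1, by simp [closedUpperHalfPlane]⟩
  · refine Set.Subset.antisymm ?_ (convexHull_min hW (convex_upperBild _))
    refine upperBild_subset_of_convex A (convex_convexHull ℝ _) ?_ ?_ fun r hr => ?_
    · exact fun z hz => subset_convexHull ℝ _ (Or.inl hz)
    · exact fun z hz => subset_convexHull ℝ _ (Or.inr hz)
    · rw [hempty] at hr; exact hr.elim
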